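/- Theorem 1.9. Let $m\ge 1$ and let $0<k_1<\cdots<k_m<d$ be integers with $\gcd(k_1,\dots,k_m,d)=1$. Put $$A=\begin{pmatrix}1&1&\cdots&1&1\\ 0&k_1&\cdots&k_m&d\end{pmatrix},$$ and index its columns, and the variables $x=(x_0,x_{k_1},\dots,x_{k_m},x_d)$, by $J=\{0,k_1,\dots,k_m,d\}$. For $\alpha=(\alpha_1,\alpha_2)$, the $A$-hypergeometric system with exponent $\alpha$ consists of the equations $$\prod_{v_j>0}\Bigl(\frac{\partial}{\partial x_j}\Bigr)^{v_j}\varphi=\prod_{v_j<0}\Bigl(\frac{\partial}{\partial x_j}\Bigr)^{-v_j}\varphi\qquad\text{for all } v\in\mathbb Z^{J}\text{ with }Av=0,$$ $$\sum_{j\in J}x_j\frac{\partial\varphi}{\partial x_j}=\alpha_1\varphi,\qquad \sum_{j\in J}j\,x_j\frac{\partial\varphi}{\partial x_j}=\alpha_2\varphi .$$ If $\alpha\in\mathbb Z^2$ lies in the Euler–Jacobi cone, that is, $d\alpha_1<\alpha_2<0$, then this system has no nonzero rational solution: the only $\varphi\in\mathbb C(x_0,x_{k_1},\dots,x_{k_m},x_d)$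 satisfying it is $\varphi=0$. -/

import Mathlib

open MvPolynomial

noncomputable section

namespace AHypergeometric

/-- The field `ℂ(x_1, …, x_r)` of rational functions in `r` variables. -/
abbrev RatFun (r : ℕ) : Type := FractionRing (MvPolynomial (Fin r) ℂ)

/-- The inclusion of the polynomials into the rational functions. -/
abbrev ofPoly (r : ℕ) : MvPolynomial (Fin r) ℂ →+* RatFun r :=
  algebraMap (MvPolynomial (Fin r) ℂ) (RatFun r)

/-- Quotient rule applied to the fraction `p / q`. -/
def quotRule {r : ℕ} (j : Fin r) (p q : MvPolynomial (Fin r) ℂ) : RatFun r :=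
  ofPoly r (pderiv j p * q - p * pderiv j q) / ofPoly r q ^ 2

theorem ofPoly_ne_zero {r : ℕ} {q : MvPolynomial (Fin r) ℂ} (hq : q ≠ 0) : ofPoly r q ≠ 0 := by
  simpa using hq

theorem exists_frac {r : ℕ} (φ : RatFun r) :
    ∃ p q : MvPolynomial (Fin r) ℂ, q ≠ 0 ∧ φ = ofPoly r p / ofPoly r q := by
  obtain ⟨p, q, hq, h⟩ := IsFractionRing.div_surjective (A := MvPolynomial (Fin r) ℂ) φ
  exact ⟨p, q, nonZeroDivisors.ne_zero hq, h.symm⟩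

theorem quotRule_congr {r : ℕ} (j : Fin r) {p q p' q' : MvPolynomial (Fin r) ℂ}
    (hq : q ≠ 0) (hq' : q' ≠ 0) (h : ofPoly r p / ofPoly r q = ofPoly r p' / ofPoly r q') :
    quotRule j p q = quotRule j p' q' := by
  have h1 : p * q' = p' * q := by
    rw [div_eq_div_iff (ofPoly_ne_zero hq) (ofPoly_ne_zero hq')] at h
    exact IsFractionRing.injective (MvPolynomial (Fin r) ℂ) (RatFun r) (by simpa using h)
  have h2 : pderiv j p * q' + p * pderiv j q' = pderiv j p' * q + p' * pderiv j q := by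
    have := congrArg (pderiv j) h1
    rwa [pderiv_mul, pderiv_mul] at this
  unfold quotRule
  rw [div_eq_div_iff (pow_ne_zero 2 (ofPoly_ne_zero hq)) (pow_ne_zero 2 (ofPoly_ne_zero hq')),
    ← map_pow, ← map_pow, ← map_mul, ← map_mul]
  refine congrArg (ofPoly r) ?_
  linear_combination (q * q') * h2 - (q * pderiv j q' + q' * pderiv j q) * h1

/-- The value at `φ` of the partial derivative `∂/∂x_j`, by the quotient rule. -/
def partialFun {r : ℕ} (j : Fin r) (φ : RatFun r) : RatFun r :=
  quotRule j (exists_frac φ).choose (exists_frac φ).choose_spec.choose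

theorem partialFun_div {r : ℕ} (j : Fin r) (p : MvPolynomial (Fin r) ℂ)
    {q : MvPolynomial (Fin r) ℂ} (hq : q ≠ 0) :
    partialFun j (ofPoly r p / ofPoly r q) = quotRule j p q := by
  obtain ⟨h1, h2⟩ := (exists_frac (ofPoly r p / ofPoly r q)).choose_spec.choose_spec
  exact quotRule_congr j h1 hq h2.symm

theorem partialFun_add {r : ℕ} (j : Fin r) (φ ψ : RatFun r) :
    partialFun j (φ + ψ) = partialFun j φ + partialFun j ψ := by
  obtain ⟨p, q, hq, rfl⟩ := exists_frac φ
  obtain ⟨s, t, ht, rfl⟩ := exists_frac ψ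
  have hq' := ofPoly_ne_zero hq
  have ht' := ofPoly_ne_zero ht
  have : ofPoly r p / ofPoly r q + ofPoly r s / ofPoly r t
      = ofPoly r (p * t + q * s) / ofPoly r (q * t) := by
    rw [div_add_div _ _ hq' ht']; simp only [map_add, map_mul]
  rw [this, partialFun_div j _ (mul_ne_zero hq ht), partialFun_div j _ hq, partialFun_div j _ ht]
  simp only [quotRule, map_add, map_mul, map_sub, pderiv_mul]
  field_simp
  ring

theorem partialFun_mul {r : ℕ} (j : Fin r) (φ ψ : RatFun r) :
    partialFun j (φ * ψ) = φ * partialFun j ψ + ψ * partialFun j φ := by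
  obtain ⟨p, q, hq, rfl⟩ := exists_frac φ
  obtain ⟨s, t, ht, rfl⟩ := exists_frac ψ
  have hq' := ofPoly_ne_zero hq
  have ht' := ofPoly_ne_zero ht
  have : ofPoly r p / ofPoly r q * (ofPoly r s / ofPoly r t)
      = ofPoly r (p * s) / ofPoly r (q * t) := by
    rw [div_mul_div_comm]; simp only [map_mul]
  rw [this, partialFun_div j _ (mul_ne_zero hq ht), partialFun_div j _ hq, partialFun_div j _ ht]
  simp only [quotRule, map_add, map_mul, map_sub, pderiv_mul]
  field_simp
  ring

theorem partialFun_ofPoly {r : ℕ} (j : Fin r) (p : MvPolynomial (Fin r) ℂ) :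
    partialFun j (ofPoly r p) = ofPoly r (pderiv j p) := by
  have := partialFun_div j p (one_ne_zero (α := MvPolynomial (Fin r) ℂ))
  simpa [quotRule] using this

/-- The partial derivative `∂/∂x_j` as a `ℂ`-linear derivation of `ℂ(x_1, …, x_r)`. -/
def partialD {r : ℕ} (j : Fin r) : Derivation ℂ (RatFun r) (RatFun r) :=
  Derivation.mk'
    { toFun := partialFun j
      map_add' := partialFun_add j
      map_smul' := fun c φ => by
        have h : algebraMap ℂ (RatFun r) c = ofPoly r (C c) :=
          IsScalarTower.algebraMap_apply ℂ (MvPolynomial (Fin r) ℂ) (RatFun r) c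
        rw [Algebra.smul_def, partialFun_mul, h, partialFun_ofPoly, pderiv_C, map_zero, mul_zero,
          add_zero, RingHom.id_apply, Algebra.smul_def, h] }
    (fun φ ψ => partialFun_mul j φ ψ)

/-- The differential operator `∂^{|u|}/∂x^u = ∏_j (∂/∂x_j)^{u_j}`. -/
def monomialD {r : ℕ} (u : Fin r → ℕ) : Module.End ℂ (RatFun r) :=
  (List.ofFn fun j : Fin r => ((partialD j : RatFun r →ₗ[ℂ] RatFun r) : Module.End ℂ (RatFun r))
    ^ u j).prod

/-- The toric operator
`D_v = ∏_{v_j > 0} (∂/∂x_j)^{v_j} - ∏_{v_j < 0} (∂/∂x_j)^{-v_j}`. -/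
def toricD {r : ℕ} (v : Fin r → ℤ) : Module.End ℂ (RatFun r) :=
  monomialD (fun j => (v j).toNat) - monomialD (fun j => (-v j).toNat)

/-- The rational function `φ` is a solution of the `A`-hypergeometric system with exponent `α`:
`D_v φ = 0` for all `v ∈ ℤ^r` with `A v = 0`, and
`∑_j A_{ij} x_j ∂φ/∂x_j = α_i φ` for every row `i`. -/
structure IsRationalSolution {n r : ℕ} (A : Matrix (Fin n) (Fin r) ℤ) (α : Fin n → ℂ)
    (φ : RatFun r) : Prop where
  toric : ∀ v : Fin r → ℤ, A.mulVec v = 0 → toricD v φ = 0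
  euler : ∀ i : Fin n,
    ∑ j : Fin r, (A i j : RatFun r) * ofPoly r (X j) * partialD j φ = α i • φ

/-- The matrix with rows `(1, 1, …, 1, 1)` and `(0, k_1, …, k_m, d)`. -/
def monomialCurveMatrix {m : ℕ} (k : Fin m → ℕ) (d : ℕ) : Matrix (Fin 2) (Fin (m + 2)) ℤ :=
  Matrix.of ![fun _ => 1,
    Fin.cons (α := fun _ => ℤ) 0 (Fin.snoc (α := fun _ => ℤ) (fun i => (k i : ℤ)) (d : ℤ))]

/-- The Euler-Jacobi cone `{(α₁, α₂) ∈ ℤ² : d α₁ < α₂ < 0}`. -/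
def eulerJacobiCone (d : ℕ) : Set (Fin 2 → ℤ) :=
  {α | (d : ℤ) * α 0 < α 1 ∧ α 1 < 0}

end AHypergeometric

end

/-!
Expand a rational solution `φ` in powers of a middle variable `x_j`. The toric equation
`∂_j^d φ = ∂_0^{d - k_j} ∂_d^{k_j} φ` rules out a pole along `x_j = 0`, so the lowest coefficient,
of order `N ≥ 0`, solves the system in the remaining variables with exponent `α - N (1, k_j)`, still
in the Euler–Jacobi cone. This leaves three variables `x_0, x_j, x_d` of weights `0, q, d = p + q`.

The two Euler equations then express `x_0 ∂_0` and `x_d ∂_d` through `θ = x_j ∂_j`, and the toric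
equation becomes an ordinary differential equation `c ∂_j^d φ = W(θ) φ` with `∂_j c = 0`, where
`W` is monic of degree `d`. By the lowest two coefficients of its Laurent expansion, a solution can
have a pole of order `-M` away from `x_j = 0` only if `M` is determined by the sum of the roots of
`W`; here this means `M = α₁ + 1/2`, which is not an integer. So `φ` is a polynomial in `x_j`, and
its degree is a root of `W`. In the Euler–Jacobi cone, all roots of `W` are negative.
-/

open scoped Polynomial LaurentSeries RatFunc

noncomputable section

namespace AHypergeometric

section Operators

theorem map_aeval_apply {K M N : Type*} [CommSemiring K] [AddCommMonoid M] [Module K M]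
    [AddCommMonoid N] [Module K N] (f : M →ₗ[K] N) {S : Module.End K M} {T : Module.End K N}
    (h : ∀ m, f (S m) = T (f m)) (P : K[X]) (m : M) :
    f (Polynomial.aeval S P m) = Polynomial.aeval T P (f m) := by
  induction P using Polynomial.induction_on generalizing m with
  | C c => simp only [Polynomial.aeval_C, Module.algebraMap_end_apply, map_smul]
  | add P Q hP hQ => simp only [map_add, LinearMap.add_apply, hP, hQ]
  | monomial n c ih =>
    simp only [pow_succ, ← mul_assoc, map_mul _ _ Polynomial.X, Polynomial.aeval_X,
      Module.End.mul_apply] at ih ⊢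
    rw [ih, h]

variable {K M : Type*} [CommSemiring K] [AddCommMonoid M] [Module K M]

theorem aeval_aeval_apply_of_apply_eq_aeval {S T : Module.End K M} (hST : Commute S T) {Q : K[X]}
    {m : M} (h : S m = Polynomial.aeval T Q m) (P R : K[X]) :
    Polynomial.aeval S P (Polynomial.aeval T R m) = Polynomial.aeval T (P.comp Q * R) m := by
  induction P using Polynomial.induction_on with
  | C c => simp
  | add P P' hP hP' =>
    simp only [map_add, LinearMap.add_apply, Polynomial.add_comp, add_mul, hP, hP']
  | monomial n c ih =>
    have hS : ∀ R : K[X], S (Polynomial.aeval T R m) = Polynomial.aeval T R (S m) := fun R =>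
      map_aeval_apply S (fun m => LinearMap.congr_fun hST m) R m
    have hX : (Polynomial.C c * Polynomial.X ^ (n + 1) : K[X]) =
        Polynomial.X * (Polynomial.C c * Polynomial.X ^ n) := by ring
    rw [hX, map_mul, Polynomial.aeval_X, Module.End.mul_apply, ih, hS, h,
      Polynomial.mul_comp Polynomial.X, Polynomial.X_comp, mul_assoc, mul_comm Q, map_mul _ _ Q,
      Module.End.mul_apply]

end Operators

section EulerOperator

variable {K A : Type*} [CommRing K] [CommRing A] [Algebra K A]

/-- The Euler operator `x D` of a derivation `D` with respect to a coordinate `x`. -/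
def eulerOperator (D : Derivation K A A) (x : A) : Module.End K A := (x • D).toLinearMap

theorem eulerOperator_apply (D : Derivation K A A) (x f : A) : eulerOperator D x f = x * D f := rfl

theorem pow_mul_iterate_derivation (D : Derivation K A A) {x : A} (hx : D x = 1) (n : ℕ) (f : A) :
    x ^ n * D^[n] f = Polynomial.aeval (eulerOperator D x) (descPochhammer K n) f := by
  induction n with
  | zero => simp
  | succ n ih =>
    have hxn : x * D (x ^ n) = n * x ^ n := by
      rw [Derivation.leibniz_pow, hx, smul_eq_mul, mul_one, nsmul_eq_mul]
      rcases n with _ | n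
      · simp
      · rw [Nat.add_sub_cancel]; ring
    rw [descPochhammer_succ_right, mul_comm (descPochhammer K n), map_mul, Module.End.mul_apply,
      ← ih, map_sub, Polynomial.aeval_X, map_natCast, LinearMap.sub_apply, Module.End.natCast_apply,
      eulerOperator_apply, Derivation.leibniz, Function.iterate_succ_apply', nsmul_eq_mul]
    simp only [smul_eq_mul]
    linear_combination -D^[n] f * hxn

end EulerOperator

section HahnSeries

variable {Γ K A : Type*} [AddCommMonoid Γ] [PartialOrder Γ] [IsOrderedCancelAddMonoid Γ]
  [CommRing K] [CommRing A] [Algebra K A]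

/-- The derivation of Hahn series given on the `n`-th coefficients by the additive maps `δ n`, such
as the Euler operator `T d/dT` or a derivation of the coefficients. -/
def coeffwiseDerivation (δ : Γ → A →ₗ[K] A)
    (hδ : ∀ i j a b, δ (i + j) (a * b) = a * δ j b + b * δ i a) :
    Derivation K (HahnSeries Γ A) (HahnSeries Γ A) :=
  let toHahn (f : HahnSeries Γ A) : HahnSeries Γ A :=
    { coeff := fun n => δ n (f.coeff n)
      isPWO_support' := f.isPWO_support.mono fun n =>
        mt fun h => (congrArg (δ n) h).trans (map_zero _) }
  have support_subset (f : HahnSeries Γ A) : (toHahn f).support ⊆ f.support :=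
    fun n => mt fun h => (congrArg (δ n) h).trans (map_zero _)
  Derivation.mk'
    { toFun := toHahn
      map_add' := fun f g => HahnSeries.ext (funext fun n => map_add (δ n) _ _)
      map_smul' := fun c f => HahnSeries.ext (funext fun n => map_smul (δ n) c _) }
    fun f g => by
      ext n
      change δ n ((f * g).coeff n) = (f * toHahn g + g * toHahn f).coeff n
      rw [mul_comm g, HahnSeries.coeff_add, HahnSeries.coeff_mul,
        HahnSeries.coeff_mul_right' g.isPWO_support (support_subset g),
        HahnSeries.coeff_mul_left' f.isPWO_support (support_subset f), ← Finset.sum_add_distrib,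
        map_sum]
      refine Finset.sum_congr rfl fun ij hij => ?_
      rw [Finset.mem_antidiagonal] at hij
      rw [← hij.2.2, hδ, mul_comm (g.coeff _)]

theorem coeff_coeffwiseDerivation (δ : Γ → A →ₗ[K] A)
    (hδ : ∀ i j a b, δ (i + j) (a * b) = a * δ j b + b * δ i a) (f : HahnSeries Γ A) (n : Γ) :
    (coeffwiseDerivation δ hδ f).coeff n = δ n (f.coeff n) := rfl

end HahnSeries

/-- The coefficientwise algebra structure, preferred to the one that factors through `F⟦X⟧`, whose
module structure is not the coefficientwise one by definition. -/
local instance laurentAlgebra {K F : Type*} [CommSemiring K] [Semiring F] [Algebra K F] :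
    Algebra K F⸨X⸩ := HahnSeries.instAlgebra

section LaurentSeries

variable (K : Type*) {F : Type*} [Field K] [Field F] [Algebra K F]

/-- The derivation `d/dT` of the Laurent series in `T`. -/
def laurentDerivation : Derivation K F⸨X⸩ F⸨X⸩ :=
  Derivation.mk' (LaurentSeries.derivative K) fun f g => by
    let θ : Derivation K F⸨X⸩ F⸨X⸩ :=
      coeffwiseDerivation (fun n => n • LinearMap.id) fun i j a b => by
        simp only [add_smul, LinearMap.add_apply, LinearMap.smul_apply, LinearMap.id_apply,
          mul_smul_comm]
        rw [add_comm, mul_comm a b]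
    have hθ : ∀ f : F⸨X⸩, LaurentSeries.derivative K f = HahnSeries.single (-1) 1 * θ f := by
      intro f
      ext n
      rw [HahnSeries.coeff_single_mul, sub_neg_eq_add, one_mul, LaurentSeries.derivative_apply,
        LaurentSeries.hasseDeriv_coeff, Ring.choose_one_right]
      rfl
    simp only [hθ, Derivation.leibniz, smul_eq_mul]
    ring

theorem coeff_iterate_laurentDerivation (d : ℕ) (f : F⸨X⸩) (n : ℤ) :
    ((laurentDerivation K)^[d] f).coeff n =
      (∏ i ∈ Finset.range d, ((n : F) + d - i)) * f.coeff (n + d) := by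
  have h := LaurentSeries.derivative_iterate_coeff (R := K) d f n
  rw [← Polynomial.eval_eq_smeval, descPochhammer_eval_eq_prod_range, zsmul_eq_mul] at h
  exact_mod_cast h

theorem coeff_laurentDerivation (f : F⸨X⸩) (n : ℤ) :
    (laurentDerivation K f).coeff n = (n + 1) * f.coeff (n + 1) := by
  simpa using coeff_iterate_laurentDerivation K 1 f n

theorem laurentDerivation_C (c : F) : laurentDerivation K (HahnSeries.C c) = 0 := by
  ext n
  rw [coeff_laurentDerivation, HahnSeries.C_apply, HahnSeries.coeff_single, HahnSeries.coeff_zero]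
  split_ifs with h
  · rw [← Int.cast_one, ← Int.cast_add, h, Int.cast_zero, zero_mul]
  · rw [mul_zero]

theorem laurentDerivation_single_one :
    laurentDerivation K (HahnSeries.single 1 1 : F⸨X⸩) = 1 := by
  ext n
  rw [coeff_laurentDerivation, HahnSeries.coeff_single, HahnSeries.coeff_one]
  by_cases h : n = 0 <;> simp [h]

theorem laurentDerivation_C_add_single_one (a : F) :
    laurentDerivation K (HahnSeries.C a + HahnSeries.single 1 1) = 1 := by
  rw [map_add, laurentDerivation_C, laurentDerivation_single_one, zero_add]

/-- The Euler operator `x d/dx` in terms of the local parameter `T = x - a`. -/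
def laurentEuler (a : F) : Module.End K F⸨X⸩ :=
  eulerOperator (laurentDerivation K) (HahnSeries.C a + HahnSeries.single 1 1 : F⸨X⸩)

theorem coeff_C_add_single_one_mul (a : F) (f : F⸨X⸩) (n : ℤ) :
    ((HahnSeries.C a + HahnSeries.single 1 1) * f).coeff n = a * f.coeff n + f.coeff (n - 1) := by
  rw [add_mul, HahnSeries.coeff_add, HahnSeries.C_apply, HahnSeries.coeff_single_mul,
    HahnSeries.coeff_single_mul, sub_zero, one_mul]

theorem coeff_laurentEuler (a : F) (f : F⸨X⸩) (n : ℤ) :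
    (laurentEuler K a f).coeff n = a * ((n + 1) * f.coeff (n + 1)) + n * f.coeff n := by
  rw [laurentEuler, eulerOperator_apply, coeff_C_add_single_one_mul, coeff_laurentDerivation,
    coeff_laurentDerivation]
  simp

variable {K}

theorem coeff_aeval_laurentEuler_zero (P : K[X]) (f : F⸨X⸩) (n : ℤ) :
    (Polynomial.aeval (laurentEuler K 0) P f).coeff n =
      Polynomial.aeval (n : F) P * f.coeff n := by
  induction P using Polynomial.induction_on with
  | C c => rw [Polynomial.aeval_C, Polynomial.aeval_C, Module.algebraMap_end_apply,
      HahnSeries.coeff_smul, Algebra.smul_def]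
  | add P Q hP hQ => simp only [map_add, LinearMap.add_apply, HahnSeries.coeff_add, hP, hQ, add_mul]
  | monomial k c ih =>
    have hX : (Polynomial.C c * Polynomial.X ^ (k + 1) : K[X]) =
        Polynomial.X * (Polynomial.C c * Polynomial.X ^ k) := by ring
    rw [hX, map_mul, map_mul (Polynomial.aeval (n : F)), Polynomial.aeval_X, Polynomial.aeval_X,
      Module.End.mul_apply, coeff_laurentEuler, ih, zero_mul, zero_add, mul_assoc]

end LaurentSeries

section Pole

theorem two_mul_coeff_descPochhammer_succ (R : Type*) [CommRing R] [Nontrivial R]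
    [NoZeroDivisors R] (n : ℕ) : 2 * (descPochhammer R (n + 1)).coeff n = -((n + 1) * n) := by
  induction n with
  | zero => simp
  | succ n ih =>
    have hlead : (descPochhammer R (n + 1)).coeff (n + 1) = 1 := by
      simpa only [Polynomial.Monic, Polynomial.leadingCoeff, descPochhammer_natDegree] using
        monic_descPochhammer R (n + 1)
    rw [descPochhammer_succ_right, ← map_natCast Polynomial.C, Polynomial.coeff_mul_X_sub_C, hlead,
      mul_sub, ih]
    push_cast
    ring

variable {K F : Type*} [Field K] [Field F] [Algebra K F]

theorem coeff_C_add_single_one_pow_mul (a : F) {g : F⸨X⸩} {N : ℤ} (hg : ∀ n < N, g.coeff n = 0)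
    (d : ℕ) :
    (∀ n < N, ((HahnSeries.C a + HahnSeries.single 1 1) ^ d * g).coeff n = 0) ∧
    ((HahnSeries.C a + HahnSeries.single 1 1) ^ d * g).coeff N = a ^ d * g.coeff N ∧
    ((HahnSeries.C a + HahnSeries.single 1 1) ^ (d + 1) * g).coeff (N + 1) =
      a ^ (d + 1) * g.coeff (N + 1) + (d + 1) * a ^ d * g.coeff N := by
  induction d with
  | zero =>
    refine ⟨by simpa using hg, by simp, ?_⟩
    rw [zero_add, pow_one, pow_one, coeff_C_add_single_one_mul, add_sub_cancel_right]
    simp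
  | succ d ih =>
    obtain ⟨h₁, h₂, h₃⟩ := ih
    have h₂' : ((HahnSeries.C a + HahnSeries.single 1 1) ^ (d + 1) * g).coeff N =
        a ^ (d + 1) * g.coeff N := by
      rw [pow_succ', mul_assoc, coeff_C_add_single_one_mul, h₂, h₁ _ (by lia)]
      ring
    refine ⟨fun n hn => ?_, h₂', ?_⟩
    · rw [pow_succ', mul_assoc, coeff_C_add_single_one_mul, h₁ _ hn, h₁ _ (by lia)]
      ring
    · rw [pow_succ', mul_assoc, coeff_C_add_single_one_mul, h₃, add_sub_cancel_right, h₂']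
      push_cast
      ring

theorem coeff_aeval_laurentEuler {a : F} {f : F⸨X⸩} {M : ℤ} (hf : ∀ n < M, f.coeff n = 0) {n : ℕ}
    {Q : K[X]} (hQ : Q.natDegree ≤ n) :
    (∀ N < M - n, (Polynomial.aeval (laurentEuler K a) Q f).coeff N = 0) ∧
    (Polynomial.aeval (laurentEuler K a) Q f).coeff (M - n) =
      algebraMap K F (Q.coeff n) * a ^ n * (∏ i ∈ Finset.range n, ((M : F) - i)) * f.coeff M := by
  induction n generalizing Q with
  | zero =>
    rw [Polynomial.eq_C_of_natDegree_le_zero hQ, Polynomial.aeval_C, Module.algebraMap_end_apply]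
    refine ⟨fun N hN => ?_, ?_⟩
    · rw [HahnSeries.coeff_smul, hf N (by simpa using hN), smul_zero]
    · rw [HahnSeries.coeff_smul, Algebra.smul_def]
      simp
  | succ n ih =>
    obtain ⟨hlow, hlead⟩ := ih (Q := Q.divX) <| by
      rw [Polynomial.natDegree_divX_eq_natDegree_tsub_one]
      lia
    have hcoeff : ∀ N < M, (Polynomial.aeval (laurentEuler K a) Q f).coeff N =
        a * ((N + 1) * (Polynomial.aeval (laurentEuler K a) Q.divX f).coeff (N + 1)) +
          N * (Polynomial.aeval (laurentEuler K a) Q.divX f).coeff N := by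
      intro N hN
      conv_lhs => rw [← Polynomial.X_mul_divX_add Q]
      rw [map_add, map_mul, Polynomial.aeval_X, Polynomial.aeval_C, LinearMap.add_apply,
        Module.End.mul_apply, Module.algebraMap_end_apply, HahnSeries.coeff_add,
        HahnSeries.coeff_smul, hf N hN, smul_zero, add_zero, coeff_laurentEuler]
    push_cast
    refine ⟨fun N hN => ?_, ?_⟩
    · rw [hcoeff N (by lia), hlow _ (by lia), hlow _ (by lia)]
      ring
    · rw [hcoeff _ (by lia), hlow (M - (n + 1)) (by lia), show M - (n + 1 : ℤ) + 1 = M - n by ring,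
        hlead, Polynomial.coeff_divX, Finset.prod_range_succ]
      push_cast
      ring

theorem coeff_iterate_laurentDerivation_of_lt {f : F⸨X⸩} {M : ℤ} (hf : ∀ n < M, f.coeff n = 0)
    (d : ℕ) :
    (∀ n < M - d, ((laurentDerivation K)^[d] f).coeff n = 0) ∧
    ((laurentDerivation K)^[d] f).coeff (M - d) =
      (∏ i ∈ Finset.range d, ((M : F) - i)) * f.coeff M := by
  refine ⟨fun n hn => ?_, ?_⟩
  · rw [coeff_iterate_laurentDerivation, hf _ (by lia), mul_zero]
  · rw [coeff_iterate_laurentDerivation]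
    push_cast
    simp only [sub_add_cancel]

theorem prod_range_intCast_sub_ne_zero [CharZero F] {M : ℤ} (hM : M < 0) (n : ℕ) :
    ∏ i ∈ Finset.range n, ((M : F) - i) ≠ 0 :=
  Finset.prod_ne_zero_iff.2 fun i _ => by
    rw [sub_ne_zero]
    exact_mod_cast (by lia : M ≠ i)

theorem two_mul_coeff_eq_of_pole [CharZero K] {P : K[X]} {n : ℕ} (hP : P.IsMonicOfDegree (n + 1))
    {a c : F} (hc : c ≠ 0) {f : F⸨X⸩} (hf : f.order < 0)
    (h : HahnSeries.C c * (laurentDerivation K)^[n + 1] f =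
      Polynomial.aeval (laurentEuler K a) P f) :
    2 * P.coeff n = (n + 1) * (n - 2 * f.order) := by
  have := charZero_of_injective_algebraMap (algebraMap K F).injective
  have hlow : ∀ N < f.order, f.coeff N = 0 := fun N => HahnSeries.coeff_eq_zero_of_lt_order
  have hlead : f.coeff f.order ≠ 0 :=
    mt HahnSeries.coeff_order_eq_zero.1 fun h0 => by simp [h0] at hf
  set M := f.order
  let x : F⸨X⸩ := HahnSeries.C a + HahnSeries.single 1 1
  set g := (laurentDerivation K)^[n + 1] f with hg
  -- As `x ^ (n + 1) * (d/dx) ^ (n + 1)` is `descPochhammer K (n + 1)` in `x d/dx`, subtracting it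
  -- lowers the degree of `P`: the two lowest coefficients then involve only `f.coeff M`.
  let Q := P - descPochhammer K (n + 1)
  have hQ : Q.natDegree ≤ n := Nat.lt_succ_iff.1 <|
    hP.natDegree_sub_lt n.succ_ne_zero ⟨descPochhammer_natDegree K _, monic_descPochhammer K _⟩
  have hQf (N : ℤ) : (Polynomial.aeval (laurentEuler K a) Q f).coeff N =
      c * g.coeff N - (x ^ (n + 1) * g).coeff N := by
    rw [map_sub, LinearMap.sub_apply, ← h, HahnSeries.coeff_sub, HahnSeries.C_apply,
      HahnSeries.coeff_single_zero_mul, hg,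
      pow_mul_iterate_derivation _ (laurentDerivation_C_add_single_one K a), laurentEuler]
  obtain ⟨hglow, hgM⟩ := coeff_iterate_laurentDerivation_of_lt (K := K) hlow (n + 1)
  rw [← hg] at hglow hgM
  push_cast at hglow hgM
  have hprod := prod_range_intCast_sub_ne_zero (F := F) hf
  obtain ⟨hQlow, hQlead⟩ := coeff_aeval_laurentEuler (a := a) hlow hQ
  obtain ⟨-, hxlow, -⟩ := coeff_C_add_single_one_pow_mul a hglow (n + 1)
  obtain ⟨-, -, hxlead⟩ := coeff_C_add_single_one_pow_mul a hglow n
  have hca : c = a ^ (n + 1) := by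
    have := hQlow (M - (n + 1)) (by lia)
    rw [hQf, hxlow, ← sub_mul, hgM] at this
    simpa [hprod, hlead, sub_eq_zero] using this
  have ha : a ≠ 0 := fun ha => hc (by simp [hca, ha])
  have hQn : Q.coeff n = -((n + 1) * (M - n)) := by
    refine (algebraMap K F).injective (mul_right_cancel₀
      (mul_ne_zero (mul_ne_zero (pow_ne_zero n ha) (hprod n)) hlead) ?_)
    rw [hQf, show M - (n : ℤ) = M - (n + 1) + 1 by ring, hxlead, hgM, hca,
      Finset.prod_range_succ] at hQlead
    simp only [map_neg, map_mul, map_add, map_sub, map_natCast, map_intCast, map_one]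
    linear_combination -hQlead
  rw [Polynomial.coeff_sub, sub_eq_iff_eq_add] at hQn
  linear_combination 2 * hQn + two_mul_coeff_descPochhammer_succ K n

end Pole

section Expansion

theorem exists_ofPowerSeries_eq {F : Type*} [Field F] {f : F⸨X⸩} (hf : ∀ n < 0, f.coeff n = 0) :
    ∃ g : PowerSeries F, HahnSeries.ofPowerSeries ℤ F g = f :=
  (LaurentSeries.val_le_one_iff_eq_coe F f).1 <| by
    simpa using (LaurentSeries.valuation_le_iff_coeff_lt_eq_zero F (D := 0)).2 hf

theorem ratFunc_exists_algebraMap_eq {F : Type*} [Field F] [IsAlgClosed F] {f : RatFunc F}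
    (hf : ∀ a, ∀ n < 0, (algebraMap (RatFunc F) F⸨X⸩ (RatFunc.laurent a f)).coeff n = 0) :
    ∃ p : F[X], algebraMap F[X] (RatFunc F) p = f := by
  have hroot : ∀ a, f.denom.eval a ≠ 0 := by
    intro a ha
    obtain ⟨g, hg⟩ := exists_ofPowerSeries_eq (hf a)
    have hmul : algebraMap F[X] (RatFunc F) f.denom * f = algebraMap F[X] (RatFunc F) f.num := by
      rw [mul_comm, ← eq_div_iff (RatFunc.algebraMap_ne_zero f.denom_ne_zero),
        RatFunc.num_div_denom]
    have hseries : (Polynomial.taylor a f.denom : PowerSeries F) * g =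
        (Polynomial.taylor a f.num : PowerSeries F) := by
      apply HahnSeries.ofPowerSeries_injective (Γ := ℤ)
      rw [map_mul, hg, RatFunc.coe_coe, RatFunc.coe_coe, RatFunc.coePolynomial_eq_algebraMap,
        RatFunc.coePolynomial_eq_algebraMap, ← RatFunc.laurent_algebraMap,
        ← RatFunc.laurent_algebraMap, ← map_mul, ← map_mul, hmul]
    have hnum : f.num.eval a = 0 := by
      simpa [ha, Polynomial.taylor_coeff_zero] using
        (congrArg PowerSeries.constantCoeff hseries).symm
    obtain ⟨u, v, huv⟩ := RatFunc.isCoprime_num_denom f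
    simpa [ha, hnum] using congrArg (Polynomial.eval a) huv
  have hdenom : f.denom = 1 := by
    by_contra h1
    obtain ⟨a, ha⟩ := IsAlgClosed.exists_root f.denom fun hdeg =>
      h1 ((Polynomial.Monic.degree_le_zero_iff_eq_one (RatFunc.monic_denom f)).1 hdeg.le)
    exact hroot a ha
  refine ⟨f.num, ?_⟩
  conv_rhs => rw [← RatFunc.num_div_denom f]
  rw [hdenom, map_one, div_one]

theorem algebraMap_ratFunc_C {F : Type*} [Field F] (c : F) :
    algebraMap (RatFunc F) F⸨X⸩ (RatFunc.C c) = HahnSeries.C c := by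
  rw [← RatFunc.algebraMap_C, ← RatFunc.coePolynomial_eq_algebraMap, ← RatFunc.coe_coe,
    Polynomial.coe_C, HahnSeries.ofPowerSeries_C]

variable {r : ℕ}

theorem map_derivation_of_map_X {E : Type*} [CommRing E] [Algebra ℂ E] (f : RatFun r →ₐ[ℂ] E)
    (d : Derivation ℂ (RatFun r) (RatFun r)) (D : Derivation ℂ E E)
    (h : ∀ i, f (d (ofPoly r (X i))) = D (f (ofPoly r (X i)))) (φ : RatFun r) :
    f (d φ) = D (f φ) := by
  have hpoly : ∀ p : MvPolynomial (Fin r) ℂ, f (d (ofPoly r p)) = D (f (ofPoly r p)) := by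
    intro p
    induction p using MvPolynomial.induction_on with
    | C c =>
      rw [show ofPoly r (C c) = algebraMap ℂ (RatFun r) c from rfl, AlgHom.commutes,
        Derivation.map_algebraMap, Derivation.map_algebraMap, map_zero]
    | add p q hp hq => simp only [map_add, hp, hq]
    | mul_X p i hp => simp only [map_mul, map_add, Derivation.leibniz, smul_eq_mul, hp, h]
  obtain ⟨p, q, hq, rfl⟩ := exists_frac φ
  have hq' := ofPoly_ne_zero hq
  have hpq : ofPoly r q * (ofPoly r p / ofPoly r q) = ofPoly r p := mul_div_cancel₀ _ hq'
  refine (hq'.isUnit.map f).mul_left_cancel ?_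
  have hd := hpoly p
  rw [← hpq, map_mul f, Derivation.leibniz, Derivation.leibniz, map_add] at hd
  simp only [smul_eq_mul, map_mul, hpoly q] at hd
  exact add_right_cancel hd

theorem partialD_X_self (j : Fin r) : partialD j (ofPoly r (X j)) = 1 := by
  rw [← map_one (ofPoly r), ← pderiv_X_self j]
  exact partialFun_ofPoly j (X j)

theorem partialD_X_of_ne {i j : Fin r} (h : i ≠ j) : partialD j (ofPoly r (X i)) = 0 := by
  rw [← map_zero (ofPoly r), ← pderiv_X_of_ne h]
  exact partialFun_ofPoly j (X i)

theorem partialD_comm (i j : Fin r) (φ : RatFun r) :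
    partialD i (partialD j φ) = partialD j (partialD i φ) := by
  have h : ∀ n, ⁅partialD i, partialD j⁆ (ofPoly r (X n)) = 0 := fun n => by
    have hc : ∀ s t : Fin r, partialD s (partialD t (ofPoly r (X n))) = 0 := fun s t => by
      rcases eq_or_ne n t with rfl | ht
      · rw [partialD_X_self, Derivation.map_one_eq_zero]
      · rw [partialD_X_of_ne ht, map_zero]
    rw [Derivation.commutator_apply, hc, hc, sub_zero]
  rw [← sub_eq_zero, ← Derivation.commutator_apply]
  exact map_derivation_of_map_X (AlgHom.id ℂ _) ⁅partialD i, partialD j⁆ 0 h φ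

variable (F : Type*) [Field F] [Algebra (RatFun r) F] [Algebra ℂ F] [IsScalarTower ℂ (RatFun r) F]

/-- A polynomial in `x_1, …, x_r`, viewed as a polynomial in `x_j` whose coefficients are taken in a
field `F` containing the other variables. -/
def univariate (j : Fin r) : MvPolynomial (Fin r) ℂ →ₐ[ℂ] F[X] :=
  aeval (Function.update
    (fun i => Polynomial.C (algebraMap (RatFun r) F (ofPoly r (X i)))) j Polynomial.X)

theorem univariate_injective (j : Fin r) : Function.Injective (univariate F j) := by
  have heval : (((Polynomial.aeval (algebraMap (RatFun r) F (ofPoly r (X j)))).restrictScalars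
      ℂ).comp (univariate F j)) = (IsScalarTower.toAlgHom ℂ (RatFun r) F).comp
        (IsScalarTower.toAlgHom ℂ (MvPolynomial (Fin r) ℂ) (RatFun r)) := by
    refine MvPolynomial.algHom_ext fun i => ?_
    rcases eq_or_ne i j with rfl | h <;> simp [univariate, *]
  refine Function.Injective.of_comp
    (f := Polynomial.aeval (algebraMap (RatFun r) F (ofPoly r (X j)))) ?_
  convert (algebraMap (RatFun r) F).injective.comp
    (IsFractionRing.injective (MvPolynomial (Fin r) ℂ) (RatFun r))
  exact congrArg DFunLike.coe heval

/-- A rational function in `x_1, …, x_r`, viewed as a rational function in `x_j` whose coefficients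
are taken in a field `F` containing the other variables. -/
def toRatFunc (j : Fin r) : RatFun r →ₐ[ℂ] RatFunc F :=
  IsLocalization.liftAlgHom (M := nonZeroDivisors (MvPolynomial (Fin r) ℂ))
    (f := (IsScalarTower.toAlgHom ℂ F[X] (RatFunc F)).comp (univariate F j)) fun q =>
      (RatFunc.algebraMap_ne_zero ((map_ne_zero_iff _ (univariate_injective F j)).2
        (nonZeroDivisors.coe_ne_zero q))).isUnit

variable {F}

theorem toRatFunc_ofPoly (j : Fin r) (p : MvPolynomial (Fin r) ℂ) :
    toRatFunc F j (ofPoly r p) = algebraMap F[X] (RatFunc F) (univariate F j p) :=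
  IsLocalization.lift_eq _ p

/-- The Laurent expansion of a rational function at `x_j = a`, in powers of `x_j - a`. -/
def expansion (j : Fin r) (a : F) : RatFun r →ₐ[ℂ] F⸨X⸩ where
  toRingHom := (algebraMap (RatFunc F) F⸨X⸩).comp
    ((RatFunc.laurent a : RatFunc F →+* RatFunc F).comp (toRatFunc F j : RatFun r →+* RatFunc F))
  commutes' c := by
    have hC : algebraMap ℂ (RatFunc F) c = RatFunc.C (algebraMap ℂ F c) := by
      rw [IsScalarTower.algebraMap_apply ℂ F[X] (RatFunc F), Polynomial.algebraMap_apply,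
        RatFunc.algebraMap_C]
    change algebraMap (RatFunc F) F⸨X⸩ (RatFunc.laurent a (toRatFunc F j (algebraMap ℂ _ c))) = _
    rw [AlgHom.commutes, hC, RatFunc.laurent_C, algebraMap_ratFunc_C, HahnSeries.algebraMap_apply]

theorem expansion_apply (j : Fin r) (a : F) (φ : RatFun r) :
    expansion j a φ = algebraMap (RatFunc F) F⸨X⸩ (RatFunc.laurent a (toRatFunc F j φ)) := rfl

theorem expansion_X_self (j : Fin r) (a : F) :
    expansion j a (ofPoly r (X j)) = HahnSeries.C a + HahnSeries.single 1 1 := by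
  rw [expansion_apply, toRatFunc_ofPoly, univariate, aeval_X, Function.update_self,
    RatFunc.algebraMap_X, RatFunc.laurent_X, map_add, RatFunc.coe_X, algebraMap_ratFunc_C, add_comm]

theorem expansion_X_of_ne {i j : Fin r} (h : i ≠ j) (a : F) :
    expansion j a (ofPoly r (X i)) = HahnSeries.C (algebraMap (RatFun r) F (ofPoly r (X i))) := by
  rw [expansion_apply, toRatFunc_ofPoly, univariate, aeval_X, Function.update_of_ne h,
    RatFunc.algebraMap_C, RatFunc.laurent_C, algebraMap_ratFunc_C]

theorem expansion_partialD (j : Fin r) (a : F) (φ : RatFun r) :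
    expansion j a (partialD j φ) = laurentDerivation ℂ (expansion j a φ) := by
  refine map_derivation_of_map_X (expansion j a) (partialD j) (laurentDerivation ℂ) (fun i => ?_) φ
  rcases eq_or_ne i j with rfl | h
  · rw [partialD_X_self, map_one, expansion_X_self, laurentDerivation_C_add_single_one]
  · rw [partialD_X_of_ne h, map_zero, expansion_X_of_ne h, laurentDerivation_C]

/-- The derivation `∂/∂x_i` applied to the coefficients of a Laurent series. -/
def coeffPartialD (i : Fin r) : Derivation ℂ (RatFun r)⸨X⸩ (RatFun r)⸨X⸩ :=
  coeffwiseDerivation (fun _ => (partialD i).toLinearMap) fun _ _ => (partialD i).leibniz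

theorem coeffPartialD_C (i : Fin r) (c : RatFun r) :
    coeffPartialD i (HahnSeries.C c) = HahnSeries.C (partialD i c) := by
  ext n
  by_cases hn : n = 0 <;>
    simp [coeffPartialD, coeff_coeffwiseDerivation, HahnSeries.C_apply, hn]

theorem coeffPartialD_single_one (i : Fin r) :
    coeffPartialD i (HahnSeries.single 1 1) = 0 := by
  ext n
  by_cases hn : n = 1 <;>
    simp [coeffPartialD, coeff_coeffwiseDerivation, hn]

theorem coeff_expansion_partialD_of_ne {i j : Fin r} (h : i ≠ j) (φ : RatFun r) (n : ℤ) :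
    (expansion j (0 : RatFun r) (partialD i φ)).coeff n =
      partialD i ((expansion j (0 : RatFun r) φ).coeff n) := by
  suffices hf : expansion j (0 : RatFun r) (partialD i φ) =
      coeffPartialD i (expansion j (0 : RatFun r) φ) by
    rw [hf]; rfl
  refine map_derivation_of_map_X (expansion j (0 : RatFun r)) (partialD i) (coeffPartialD i)
    (fun k => ?_) φ
  rcases eq_or_ne k j with rfl | hk
  · rw [partialD_X_of_ne h.symm, expansion_X_self, map_add, coeffPartialD_C,
      coeffPartialD_single_one, map_zero, map_zero, map_zero, add_zero]
  · rw [expansion_X_of_ne hk, coeffPartialD_C]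
    rcases eq_or_ne k i with rfl | hi
    · simp [partialD_X_self]
    · simp [partialD_X_of_ne hi]

end Expansion

section Ode

theorem eq_C_of_laurentDerivation_eq_zero {K F : Type*} [Field K] [Field F] [CharZero F]
    [Algebra K F] {f : F⸨X⸩} (hf : laurentDerivation K f = 0) : f = HahnSeries.C (f.coeff 0) := by
  ext n
  rw [HahnSeries.C_apply, HahnSeries.coeff_single]
  split_ifs with hn
  · rw [hn]
  · have h := coeff_laurentDerivation K f (n - 1)
    rw [hf, HahnSeries.coeff_zero] at h
    simpa [hn] using h

theorem eq_zero_of_polynomial_ode {K F : Type*} [Field K] [Field F] [Algebra K F] {P : K[X]}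
    (hP : ∀ k : ℕ, Polynomial.aeval (k : F) P ≠ 0) {c : F} {n : ℕ} {p : F[X]}
    (h : HahnSeries.C c * (laurentDerivation K)^[n + 1] ((p : PowerSeries F) : F⸨X⸩) =
      Polynomial.aeval (laurentEuler K 0) P ((p : PowerSeries F) : F⸨X⸩)) : p = 0 := by
  have hcoeff (k : ℕ) : (((p : PowerSeries F) : F⸨X⸩)).coeff (k : ℤ) = p.coeff k := by
    rw [LaurentSeries.coeff_coe_powerSeries, Polynomial.coeff_coe]
  have htop := congrArg (HahnSeries.coeff · (p.natDegree : ℤ)) h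
  simp only [HahnSeries.C_apply, HahnSeries.coeff_single_zero_mul, coeff_aeval_laurentEuler_zero,
    coeff_iterate_laurentDerivation, ← Nat.cast_add, hcoeff, Int.cast_natCast] at htop
  rw [Polynomial.coeff_eq_zero_of_natDegree_lt (by lia), mul_zero, mul_zero] at htop
  simpa [hP] using htop.symm

variable {r : ℕ}

/-- The Euler operator `x_j ∂/∂x_j`. -/
def theta (j : Fin r) : Module.End ℂ (RatFun r) := eulerOperator (partialD j) (ofPoly r (X j))

section

variable {F : Type*} [Field F] [Algebra (RatFun r) F] [Algebra ℂ F] [IsScalarTower ℂ (RatFun r) F]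

theorem expansion_aeval_theta (j : Fin r) (a : F) (P : ℂ[X]) (φ : RatFun r) :
    expansion j a (Polynomial.aeval (theta j) P φ) =
      Polynomial.aeval (laurentEuler ℂ a) P (expansion j a φ) :=
  map_aeval_apply (expansion j a).toLinearMap (fun ψ => by
    simp only [theta, laurentEuler, eulerOperator_apply, AlgHom.toLinearMap_apply, map_mul,
      expansion_partialD, expansion_X_self]) P φ

theorem expansion_iterate_partialD (j : Fin r) (a : F) (n : ℕ) (φ : RatFun r) :
    expansion j a ((partialD j)^[n] φ) = (laurentDerivation ℂ)^[n] (expansion j a φ) :=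
  Function.Semiconj.iterate_right (expansion_partialD j a) n φ

theorem expansion_eq_C_of_partialD_eq_zero {j : Fin r} {c : RatFun r} (hc : c ≠ 0)
    (hcj : partialD j c = 0) (a : F) : ∃ c' ≠ 0, expansion j a c = HahnSeries.C c' := by
  have := charZero_of_injective_algebraMap (algebraMap ℂ F).injective
  have h : expansion j a c = HahnSeries.C ((expansion j a c).coeff 0) :=
    eq_C_of_laurentDerivation_eq_zero (K := ℂ) (by rw [← expansion_partialD, hcj, map_zero])
  refine ⟨_, fun h0 => hc ?_, h⟩
  rwa [h0, map_zero, map_eq_zero] at h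

theorem expansion_ode {j : Fin r} {c : RatFun r} (hc : c ≠ 0) (hcj : partialD j c = 0)
    {W : ℂ[X]} {n : ℕ} {φ : RatFun r}
    (h : c * (partialD j)^[n] φ = Polynomial.aeval (theta j) W φ) (a : F) :
    ∃ c' ≠ 0, HahnSeries.C c' * (laurentDerivation ℂ)^[n] (expansion j a φ) =
      Polynomial.aeval (laurentEuler ℂ a) W (expansion j a φ) := by
  obtain ⟨c', hc', hcc'⟩ := expansion_eq_C_of_partialD_eq_zero hc hcj a
  exact ⟨c', hc', by
    rw [← expansion_aeval_theta, ← h, map_mul, hcc', expansion_iterate_partialD]⟩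

theorem exists_expansion_eq_polynomial [IsAlgClosed F] {j : Fin r} {φ : RatFun r}
    (hφ : ∀ a : F, ∀ n < 0, (expansion j a φ).coeff n = 0) :
    ∃ p : F[X], expansion j (0 : F) φ = ((p : PowerSeries F) : F⸨X⸩) := by
  obtain ⟨p, hp⟩ := ratFunc_exists_algebraMap_eq (f := toRatFunc F j φ) hφ
  refine ⟨p, ?_⟩
  rw [expansion_apply, RatFunc.laurent_at_zero, ← hp, ← RatFunc.coePolynomial_eq_algebraMap,
    ← RatFunc.coe_coe]

end

theorem eq_zero_of_ode {j : Fin r} {c : RatFun r} (hc : c ≠ 0) (hcj : partialD j c = 0)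
    {W : ℂ[X]} {n : ℕ} (hW : W.IsMonicOfDegree n)
    (hpole : ∀ M : ℤ, 2 * W.nextCoeff ≠ n * (n - 1 - 2 * M))
    (hdeg : ∀ k : ℕ, W.eval (k : ℂ) ≠ 0) {φ : RatFun r}
    (h : c * (partialD j)^[n] φ = Polynomial.aeval (theta j) W φ) : φ = 0 := by
  rcases n with _ | n
  · simp [Polynomial.nextCoeff, hW.natDegree_eq] at hpole
  have hcoeff : W.nextCoeff = W.coeff n := by
    rw [Polynomial.nextCoeff_of_natDegree_pos (by simp [hW.natDegree_eq]), hW.natDegree_eq,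
      Nat.add_sub_cancel]
  let F := AlgebraicClosure (RatFun r)
  have hreg (a : F) (k : ℤ) (hk : k < 0) : (expansion j a φ).coeff k = 0 := by
    obtain ⟨c', hc', hode⟩ := expansion_ode hc hcj h a
    by_contra hne
    refine hpole (expansion j a φ).order ?_
    rw [hcoeff, two_mul_coeff_eq_of_pole hW hc'
      ((HahnSeries.order_le_of_coeff_ne_zero hne).trans_lt hk) hode]
    push_cast
    ring
  obtain ⟨p, hp⟩ := exists_expansion_eq_polynomial hreg
  obtain ⟨c', -, hode⟩ := expansion_ode hc hcj h (0 : F)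
  have hdegF (k : ℕ) : Polynomial.aeval (k : F) W ≠ 0 := by
    rw [← map_natCast (algebraMap ℂ F), Polynomial.aeval_algebraMap_apply, Ne, map_eq_zero,
      Polynomial.coe_aeval_eq_eval]
    exact hdeg k
  rw [hp] at hode
  rw [eq_zero_of_polynomial_ode hdegF hode] at hp
  simpa using hp

end Ode

section ThreeVariables

/-- The polynomial `W` for which the system in the three variables `x_z, x_j, x_l` of weights
`0, q, p + q`, with exponent `(a, b)`, becomes the ordinary differential equation
`c (∂/∂x_j)^(p + q) φ = W(x_j ∂/∂x_j) φ`. Its roots are the exponents at `x_j = ∞`. -/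
def indicialPolynomial (p q : ℕ) (a b : ℤ) : ℂ[X] :=
  (∏ i ∈ Finset.range p, (Polynomial.X - Polynomial.C ((((p + q) * (a - i) - b) / p : ℚ) : ℂ))) *
    ∏ i ∈ Finset.range q, (Polynomial.X - Polynomial.C (((b - (p + q) * i) / q : ℚ) : ℂ))

theorem isMonicOfDegree_prod_X_sub_C {R ι : Type*} [CommRing R] [Nontrivial R] (s : Finset ι)
    (f : ι → R) : (∏ i ∈ s, (Polynomial.X - Polynomial.C (f i))).IsMonicOfDegree s.card :=
  ⟨Polynomial.natDegree_finsetProd_X_sub_C_eq_card s f, Polynomial.monic_prod_X_sub_C f s⟩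

theorem isMonicOfDegree_indicialPolynomial (p q : ℕ) (a b : ℤ) :
    (indicialPolynomial p q a b).IsMonicOfDegree (p + q) := by
  simpa [indicialPolynomial] using (isMonicOfDegree_prod_X_sub_C (Finset.range p) _).mul
    (isMonicOfDegree_prod_X_sub_C (Finset.range q) _)

theorem two_mul_nextCoeff_indicialPolynomial {p q : ℕ} (hp : p ≠ 0) (hq : q ≠ 0) (a b : ℤ) :
    2 * (indicialPolynomial p q a b).nextCoeff = (p + q) * (p + q - 2 - 2 * a) := by
  have hgauss (n : ℕ) : 2 * ∑ i ∈ Finset.range n, (i : ℂ) = n * (n - 1) := by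
    induction n with
    | zero => simp
    | succ n ih => rw [Finset.sum_range_succ, mul_add, ih]; push_cast; ring
  rw [indicialPolynomial, (Polynomial.monic_prod_X_sub_C _ _).nextCoeff_mul
    (Polynomial.monic_prod_X_sub_C _ _), Polynomial.prod_X_sub_C_nextCoeff,
    Polynomial.prod_X_sub_C_nextCoeff]
  push_cast
  simp only [← Finset.sum_div, Finset.sum_sub_distrib, ← Finset.mul_sum, Finset.sum_const,
    Finset.card_range, nsmul_eq_mul]
  field_simp
  linear_combination (p + q : ℂ) * q * hgauss p + (p + q : ℂ) * p * hgauss q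

theorem two_mul_nextCoeff_indicialPolynomial_ne {p q : ℕ} (hp : p ≠ 0) (hq : q ≠ 0) (a b M : ℤ) :
    2 * (indicialPolynomial p q a b).nextCoeff ≠ (p + q) * (p + q - 1 - 2 * M) := by
  rw [two_mul_nextCoeff_indicialPolynomial hp hq, Ne, mul_right_inj' (by norm_cast; lia)]
  norm_cast
  lia

theorem eval_indicialPolynomial_ne_zero {p q : ℕ} (hp : p ≠ 0) (hq : q ≠ 0) {a b : ℤ}
    (hab : (p + q) * a < b) (hb : b < 0) (k : ℕ) :
    (indicialPolynomial p q a b).eval (k : ℂ) ≠ 0 := by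
  have hp' : (0 : ℚ) < p := by positivity
  have hq' : (0 : ℚ) < q := by positivity
  have hab' : ((p + q) * a : ℚ) < b := by exact_mod_cast hab
  have hb' : (b : ℚ) < 0 := by exact_mod_cast hb
  have hne {ρ : ℚ} (hρ : ρ < 0) : (k : ℂ) - (ρ : ℂ) ≠ 0 := by
    rw [sub_ne_zero]
    exact_mod_cast (hρ.trans_le k.cast_nonneg).ne'
  rw [indicialPolynomial, Polynomial.eval_mul, Polynomial.eval_prod, Polynomial.eval_prod]
  simp only [Polynomial.eval_sub, Polynomial.eval_X, Polynomial.eval_C]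
  refine mul_ne_zero (Finset.prod_ne_zero_iff.2 fun i _ => hne (div_neg_of_neg_of_pos ?_ hp'))
    (Finset.prod_ne_zero_iff.2 fun i _ => hne (div_neg_of_neg_of_pos ?_ hq'))
  · have : 0 ≤ (p + q : ℚ) * i := by positivity
    linarith
  · have : 0 ≤ (p + q : ℚ) * i := by positivity
    linarith

theorem descPochhammer_comp_C_mul_X_sub_C {K : Type*} [Field K] {s : K} (hs : s ≠ 0) (t : K)
    (n : ℕ) : (descPochhammer K n).comp (Polynomial.C s * (Polynomial.X - Polynomial.C t)) =
      Polynomial.C (s ^ n) *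
        ∏ i ∈ Finset.range n, (Polynomial.X - Polynomial.C (t + i / s)) := by
  induction n with
  | zero => simp
  | succ n ih =>
    have hsn : Polynomial.C s * Polynomial.C ((n : K) / s) = (n : K[X]) := by
      rw [← Polynomial.C_mul, mul_div_cancel₀ _ hs, Polynomial.C_eq_natCast]
    rw [descPochhammer_succ_right, Polynomial.mul_comp, ih, Finset.prod_range_succ,
      Polynomial.sub_comp, Polynomial.X_comp, Polynomial.natCast_comp, ← hsn, pow_succ]
    simp only [map_add, map_mul]
    ring

theorem descPochhammer_comp_mul_descPochhammer_comp {p q : ℕ} (hp : p ≠ 0) (hq : q ≠ 0)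
    (a b : ℤ) :
    ((descPochhammer ℂ p).comp (Polynomial.C (-(p / (p + q) : ℂ)) *
      (Polynomial.X - Polynomial.C (((p + q) * a - b) / p : ℂ)))) *
    ((descPochhammer ℂ q).comp (Polynomial.C (-(q / (p + q) : ℂ)) *
      (Polynomial.X - Polynomial.C (b / q : ℂ)))) =
    Polynomial.C ((-(p / (p + q) : ℂ)) ^ p * (-(q / (p + q) : ℂ)) ^ q) *
      indicialPolynomial p q a b := by
  have hpq : (p + q : ℂ) ≠ 0 := by norm_cast; lia
  rw [descPochhammer_comp_C_mul_X_sub_C (by simp [hp, hpq]),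
    descPochhammer_comp_C_mul_X_sub_C (by simp [hq, hpq]), mul_mul_mul_comm, ← map_mul,
    indicialPolynomial]
  congr 2 <;> refine Finset.prod_congr rfl fun i _ => ?_ <;> push_cast <;> congr 2 <;>
    field_simp <;> ring

variable {r : ℕ}

theorem iterate_partialD_X_pow_mul {i j : Fin r} (h : i ≠ j) (m n : ℕ) (φ : RatFun r) :
    (partialD j)^[n] (ofPoly r (X i) ^ m * φ) = ofPoly r (X i) ^ m * (partialD j)^[n] φ := by
  refine (Function.Semiconj.iterate_right (f := (ofPoly r (X i) ^ m * ·)) (fun ψ => ?_) n φ).symm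
  simp [Derivation.leibniz_pow, partialD_X_of_ne h]

theorem commute_theta (i j : Fin r) : Commute (theta i) (theta j) := by
  rcases eq_or_ne i j with rfl | h
  · exact Commute.refl _
  · refine LinearMap.ext fun φ => ?_
    simp only [Module.End.mul_apply, theta, eulerOperator_apply, Derivation.leibniz, smul_eq_mul,
      partialD_X_of_ne h, partialD_X_of_ne h.symm, partialD_comm i j φ]
    ring

theorem monomial_mul_iterate_partialD {z j l : Fin r} (hlz : l ≠ z) {φ : RatFun r} {P Q : ℂ[X]}
    (hz : theta z φ = Polynomial.aeval (theta j) P φ)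
    (hl : theta l φ = Polynomial.aeval (theta j) Q φ) (p q : ℕ) :
    ofPoly r (X z) ^ p * ofPoly r (X l) ^ q * (partialD z)^[p] ((partialD l)^[q] φ) =
      Polynomial.aeval (theta j)
        ((descPochhammer ℂ p).comp P * (descPochhammer ℂ q).comp Q) φ := by
  have hθ (i : Fin r) (n : ℕ) (ψ : RatFun r) : ofPoly r (X i) ^ n * (partialD i)^[n] ψ =
      Polynomial.aeval (theta i) (descPochhammer ℂ n) ψ :=
    pow_mul_iterate_derivation (partialD i) (partialD_X_self i) n ψ
  have hq := aeval_aeval_apply_of_apply_eq_aeval (commute_theta l j) hl (descPochhammer ℂ q) 1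
  rw [map_one, Module.End.one_apply, mul_one] at hq
  rw [mul_assoc, ← iterate_partialD_X_pow_mul hlz, hθ, hθ, hq,
    aeval_aeval_apply_of_apply_eq_aeval (commute_theta z j) hz]

theorem eq_zero_of_three_variables {z j l : Fin r} (hzj : z ≠ j) (hlj : l ≠ j) (hlz : l ≠ z)
    {p q : ℕ} (hp : p ≠ 0) (hq : q ≠ 0) {a b : ℤ} (hab : (p + q) * a < b) (hb : b < 0)
    {φ : RatFun r} (htoric : (partialD j)^[p + q] φ = (partialD z)^[p] ((partialD l)^[q] φ))
    (hdegree : theta z φ + theta j φ + theta l φ = (a : ℂ) • φ)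
    (hweight : (q : ℂ) • theta j φ + (p + q : ℂ) • theta l φ = (b : ℂ) • φ) : φ = 0 := by
  have hpq : (p + q : ℂ) ≠ 0 := by norm_cast; lia
  have hl : theta l φ = Polynomial.aeval (theta j)
      (Polynomial.C (-(q / (p + q) : ℂ)) * (Polynomial.X - Polynomial.C (b / q : ℂ))) φ := by
    simp only [map_mul, map_sub, Polynomial.aeval_C, Polynomial.aeval_X, Module.End.mul_apply,
      Module.algebraMap_end_apply, LinearMap.sub_apply]
    linear_combination (norm := skip) (p + q : ℂ)⁻¹ • hweight
    match_scalars <;> field_simp <;> ring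
  have hz : theta z φ = Polynomial.aeval (theta j)
      (Polynomial.C (-(p / (p + q) : ℂ)) *
        (Polynomial.X - Polynomial.C (((p + q) * a - b) / p : ℂ))) φ := by
    simp only [map_mul, map_sub, Polynomial.aeval_C, Polynomial.aeval_X, Module.End.mul_apply,
      Module.algebraMap_end_apply, LinearMap.sub_apply]
    linear_combination (norm := skip) hdegree - (p + q : ℂ)⁻¹ • hweight
    match_scalars <;> field_simp <;> ring
  set u : ℂ := (-(p / (p + q) : ℂ)) ^ p * (-(q / (p + q) : ℂ)) ^ q
  have hu : u ≠ 0 := by simp [u, hp, hq, hpq]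
  have hode : (u⁻¹ • (ofPoly r (X z) ^ p * ofPoly r (X l) ^ q)) * (partialD j)^[p + q] φ =
      Polynomial.aeval (theta j) (indicialPolynomial p q a b) φ := by
    rw [htoric, smul_mul_assoc, monomial_mul_iterate_partialD hlz hz hl,
      descPochhammer_comp_mul_descPochhammer_comp hp hq, map_mul, Polynomial.aeval_C,
      Module.End.mul_apply, Module.algebraMap_end_apply, inv_smul_smul₀ hu]
  have hX (i : Fin r) : ofPoly r (X i) ≠ 0 := ofPoly_ne_zero (X_ne_zero i)
  refine eq_zero_of_ode ?_ ?_ (isMonicOfDegree_indicialPolynomial p q a b) (fun M => ?_)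
    (eval_indicialPolynomial_ne_zero hp hq hab hb) hode
  · exact smul_ne_zero (inv_ne_zero hu) (mul_ne_zero (pow_ne_zero p (hX z)) (pow_ne_zero q (hX l)))
  · simp [Derivation.leibniz_pow, partialD_X_of_ne hzj, partialD_X_of_ne hlj]
  · simpa using two_mul_nextCoeff_indicialPolynomial_ne hp hq a b M

end ThreeVariables

section Elimination

variable {r : ℕ}

theorem coeff_expansion_iterate_partialD_of_ne {i j : Fin r} (h : i ≠ j) (m : ℕ) (φ : RatFun r)
    (n : ℤ) : (expansion j (0 : RatFun r) ((partialD i)^[m] φ)).coeff n =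
      (partialD i)^[m] ((expansion j (0 : RatFun r) φ).coeff n) :=
  Function.Semiconj.iterate_right (f := fun ψ => (expansion j (0 : RatFun r) ψ).coeff n)
    (fun ψ => coeff_expansion_partialD_of_ne h ψ n) m φ

theorem coeff_expansion_theta_self (j : Fin r) (φ : RatFun r) (n : ℤ) :
    (expansion j (0 : RatFun r) (theta j φ)).coeff n =
      (n : ℂ) • (expansion j (0 : RatFun r) φ).coeff n := by
  have h := expansion_aeval_theta j (0 : RatFun r) Polynomial.X φ
  rw [Polynomial.aeval_X, Polynomial.aeval_X] at h
  rw [h, coeff_laurentEuler, zero_mul, zero_add, Algebra.smul_def, map_intCast]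

theorem coeff_expansion_theta_of_ne {i j : Fin r} (h : i ≠ j) (φ : RatFun r) (n : ℤ) :
    (expansion j (0 : RatFun r) (theta i φ)).coeff n =
      theta i ((expansion j (0 : RatFun r) φ).coeff n) := by
  rw [theta, eulerOperator_apply, eulerOperator_apply, map_mul, expansion_X_of_ne h,
    HahnSeries.C_apply, HahnSeries.coeff_single_zero_mul, coeff_expansion_partialD_of_ne h]
  rfl

theorem coeff_expansion_sum_smul_theta {T : Finset (Fin r)} {j : Fin r} (hj : j ∈ T)
    (v : Fin r → ℂ) (φ : RatFun r) (n : ℤ) :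
    (expansion j (0 : RatFun r) (∑ i ∈ T, v i • theta i φ)).coeff n =
      (v j * n) • (expansion j (0 : RatFun r) φ).coeff n +
        ∑ i ∈ T.erase j, v i • theta i ((expansion j (0 : RatFun r) φ).coeff n) := by
  rw [← Finset.add_sum_erase T _ hj, map_add, HahnSeries.coeff_add, map_smul,
    HahnSeries.coeff_smul, coeff_expansion_theta_self, mul_smul, map_sum, HahnSeries.coeff_sum]
  congr 1
  refine Finset.sum_congr rfl fun i hi => ?_
  rw [map_smul, HahnSeries.coeff_smul, coeff_expansion_theta_of_ne (Finset.ne_of_mem_erase hi)]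

theorem order_expansion_nonneg {z j l : Fin r} (hzj : z ≠ j) (hlj : l ≠ j) {d p q : ℕ} (hd : d ≠ 0)
    {φ : RatFun r} (h : (partialD j)^[d] φ = (partialD z)^[p] ((partialD l)^[q] φ)) :
    0 ≤ (expansion j (0 : RatFun r) φ).order := by
  set f := expansion j (0 : RatFun r) φ with hf
  by_contra! hN
  have hlead : f.coeff f.order ≠ 0 :=
    mt HahnSeries.coeff_order_eq_zero.1 fun h0 => by simp [h0] at hN
  have hlow : ∀ n < f.order, f.coeff n = 0 := fun n => HahnSeries.coeff_eq_zero_of_lt_order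
  have hcoeff := congrArg (fun ψ => (expansion j (0 : RatFun r) ψ).coeff (f.order - d)) h
  simp only [expansion_iterate_partialD, coeff_expansion_iterate_partialD_of_ne hzj,
    coeff_expansion_iterate_partialD_of_ne hlj, ← hf,
    hlow (f.order - d) (by lia), iterate_map_zero,
    (coeff_iterate_laurentDerivation_of_lt hlow d).2] at hcoeff
  exact mul_ne_zero (prod_range_intCast_sub_ne_zero hN d) hlead hcoeff

/-- The function `φ` solves the equations of the hypergeometric system, with exponent `(a, b)`, that
involve only the variables in `T`, of weights `w`. Of the toric equations, only those coming from
`w_l e_j - (w_l - w_j) e_z - w_j e_l` are kept, which lie in the kernel of the matrix when `x_z` has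
weight `0`. -/
structure IsReducedSolution (w : Fin r → ℕ) (z l : Fin r) (T : Finset (Fin r)) (a b : ℤ)
    (φ : RatFun r) : Prop where
  toric : ∀ j ∈ T, (partialD j)^[w l] φ = (partialD z)^[w l - w j] ((partialD l)^[w j] φ)
  degree : ∑ i ∈ T, theta i φ = (a : ℂ) • φ
  weight : ∑ i ∈ T, (w i : ℂ) • theta i φ = (b : ℂ) • φ

namespace IsReducedSolution

variable {w : Fin r → ℕ} {z l : Fin r} {T : Finset (Fin r)} {a b : ℤ} {φ : RatFun r}

theorem coeff_expansion (h : IsReducedSolution w z l T a b φ) {j : Fin r} (hj : j ∈ T)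
    (hzj : z ≠ j) (hlj : l ≠ j) (n : ℤ) :
    IsReducedSolution w z l (T.erase j) (a - n) (b - w j * n)
      ((expansion j (0 : RatFun r) φ).coeff n) where
  toric i hi := by
    rw [Finset.mem_erase] at hi
    rw [← coeff_expansion_iterate_partialD_of_ne hi.1, h.toric i hi.2,
      coeff_expansion_iterate_partialD_of_ne hzj, coeff_expansion_iterate_partialD_of_ne hlj]
  degree := by
    have hsum := coeff_expansion_sum_smul_theta hj (fun _ => 1) φ n
    simp only [one_smul, one_mul, h.degree, map_smul, HahnSeries.coeff_smul] at hsum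
    rw [Int.cast_sub, sub_smul, hsum, add_sub_cancel_left]
  weight := by
    have hsum := coeff_expansion_sum_smul_theta hj (fun i => (w i : ℂ)) φ n
    simp only [h.weight, map_smul, HahnSeries.coeff_smul] at hsum
    rw [Int.cast_sub, sub_smul, hsum, Int.cast_mul, Int.cast_natCast, add_sub_cancel_left]

theorem eq_zero_of_triple {j : Fin r} (hzj : z ≠ j) (hlj : l ≠ j) (hlz : l ≠ z)
    (hwz : w z = 0) (hwj : 0 < w j) (hwjl : w j < w l) (hab : w l * a < b) (hb : b < 0)
    (h : IsReducedSolution w z l {z, j, l} a b φ) : φ = 0 := by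
  have hcast : (w l : ℂ) = (w l - w j : ℕ) + w j := by norm_cast; lia
  have hdegree := h.degree
  have hweight := h.weight
  have hzjl : z ∉ ({j, l} : Finset (Fin r)) := by simp [hzj, hlz.symm]
  have hjl : j ∉ ({l} : Finset (Fin r)) := by simpa using hlj.symm
  rw [Finset.sum_insert hzjl, Finset.sum_insert hjl, Finset.sum_singleton] at hdegree hweight
  rw [hwz, Nat.cast_zero, zero_smul, zero_add, hcast] at hweight
  rw [← add_assoc] at hdegree
  refine eq_zero_of_three_variables hzj hlj hlz (Nat.sub_ne_zero_of_lt hwjl) hwj.ne' ?_ hb ?_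
    hdegree hweight
  · rwa [← Nat.cast_add, Nat.sub_add_cancel hwjl.le]
  · rw [Nat.sub_add_cancel hwjl.le]
    exact h.toric j (by simp)

theorem eq_zero {j : Fin r} (hzj : z ≠ j) (hlj : l ≠ j) (hlz : l ≠ z) (hw : ∀ i, w i ≤ w l)
    (hwz : w z = 0) (hwj : 0 < w j) (hwjl : w j < w l) (hT : {z, j, l} ⊆ T) (hab : w l * a < b)
    (hb : b < 0) (h : IsReducedSolution w z l T a b φ) : φ = 0 := by
  induction T using Finset.strongInduction generalizing a b φ with
  | H T ih =>
  obtain rfl | ⟨i, hiT, hi⟩ : {z, j, l} = T ∨ ∃ i ∈ T, i ∉ ({z, j, l} : Finset (Fin r)) :=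
    hT.eq_or_ssubset.imp_right Finset.exists_of_ssubset
  · exact h.eq_zero_of_triple hzj hlj hlz hwz hwj hwjl hab hb
  simp only [Finset.mem_insert, Finset.mem_singleton, not_or] at hi
  obtain ⟨hiz, hij, hil⟩ := hi
  obtain ⟨n, hn⟩ := Int.eq_ofNat_of_zero_le <|
    order_expansion_nonneg (Ne.symm hiz) (Ne.symm hil) (by lia) (h.toric i hiT)
  have hwn : (w i : ℤ) * n ≤ w l * n := by exact_mod_cast Nat.mul_le_mul_right n (hw i)
  have hwn0 : (0 : ℤ) ≤ w i * n := by positivity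
  have hlow : (expansion i (0 : RatFun r) φ).coeff n = 0 :=
    ih (T.erase i) (Finset.erase_ssubset hiT) (by grind) (by linarith) (by linarith)
      (h.coeff_expansion hiT (Ne.symm hiz) (Ne.symm hil) n)
  rwa [← hn, HahnSeries.coeff_order_eq_zero, map_eq_zero] at hlow

end IsReducedSolution

end Elimination

section MonomialCurve

theorem prod_ofFn_mul_of_commute {M : Type*} [Monoid M] {n : ℕ} {f g : Fin n → M}
    (h : ∀ i j, Commute (f i) (g j)) :
    (List.ofFn fun i => f i * g i).prod = (List.ofFn f).prod * (List.ofFn g).prod := by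
  induction n with
  | zero => simp
  | succ n ih =>
    have hcomm : Commute (List.ofFn fun i : Fin n => f i.succ).prod (g 0) :=
      Commute.list_prod_left _ _ (List.forall_mem_ofFn_iff.2 fun i => h i.succ 0)
    simp only [List.ofFn_succ, List.prod_cons]
    rw [ih fun i j => h i.succ j.succ, mul_assoc, mul_assoc, ← mul_assoc (g 0), ← hcomm.eq,
      mul_assoc]

section

variable {r : ℕ}

theorem monomialD_add (u v : Fin r → ℕ) : monomialD (u + v) = monomialD u * monomialD v := by
  simp only [monomialD, Pi.add_apply, pow_add]
  exact prod_ofFn_mul_of_commute fun i j =>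
    Commute.pow_pow (LinearMap.ext (partialD_comm i j)) (u i) (v j)

theorem monomialD_single (j : Fin r) (n : ℕ) (φ : RatFun r) :
    monomialD (Pi.single j n) φ = (partialD j)^[n] φ := by
  rw [monomialD, List.ofFn_eq_map, List.prod_map_eq_pow_single j _ fun i hi _ => by
      rw [Pi.single_eq_of_ne hi, pow_zero], List.count_eq_one_of_mem (List.nodup_finRange r)
      (List.mem_finRange j), pow_one, Pi.single_eq_same, Module.End.pow_apply]
  rfl

theorem IsRationalSolution.monomialD_apply_eq {n : ℕ} {A : Matrix (Fin n) (Fin r) ℤ}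
    {α : Fin n → ℂ} {φ : RatFun r} (h : IsRationalSolution A α φ) {u v : Fin r → ℕ}
    (huv : A.mulVec (fun i => (u i : ℤ)) = A.mulVec (fun i => (v i : ℤ))) :
    monomialD u φ = monomialD v φ := by
  have htoric := h.toric (fun i => (u i : ℤ) - v i) <|
    (A.mulVec_sub _ _).trans (sub_eq_zero.2 huv)
  rw [toricD, LinearMap.sub_apply, sub_eq_zero] at htoric
  have hu : u = u ⊓ v + fun i => ((u i : ℤ) - v i).toNat := by
    ext i; simp only [Pi.add_apply, Pi.inf_apply]; lia
  have hv : v = u ⊓ v + fun i => (-((u i : ℤ) - v i)).toNat := by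
    ext i; simp only [Pi.add_apply, Pi.inf_apply]; lia
  rw [hu, monomialD_add, Module.End.mul_apply, htoric, ← Module.End.mul_apply, ← monomialD_add,
    ← hv]

end

variable {m : ℕ} (k : Fin m → ℕ) (d : ℕ)

/-- The weights `0, k_1, …, k_m, d` of the variables. -/
def curveWeight : Fin (m + 2) → ℕ :=
  Fin.cons (α := fun _ => ℕ) 0 (Fin.snoc (α := fun _ => ℕ) k d)

theorem curveWeight_zero : curveWeight k d 0 = 0 := rfl

theorem curveWeight_last : curveWeight k d (Fin.last (m + 1)) = d := by
  rw [curveWeight, ← Fin.succ_last, Fin.cons_succ, Fin.snoc_last]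

theorem curveWeight_succ_castSucc (i : Fin m) : curveWeight k d i.castSucc.succ = k i := by
  rw [curveWeight, Fin.cons_succ, Fin.snoc_castSucc]

variable {k d}

theorem curveWeight_le (hk : ∀ i, k i ≤ d) (i : Fin (m + 2)) : curveWeight k d i ≤ d := by
  refine Fin.cases (Nat.zero_le _) (Fin.lastCases ?_ fun i => ?_) i
  · rw [Fin.succ_last, curveWeight_last]
  · rw [curveWeight_succ_castSucc]
    exact hk i

theorem monomialCurveMatrix_one (i : Fin (m + 2)) :
    monomialCurveMatrix k d 1 i = curveWeight k d i := by
  refine Fin.cases rfl (Fin.lastCases ?_ fun i => ?_) i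
  · rw [Fin.succ_last, curveWeight_last, ← Fin.succ_last]
    simp [monomialCurveMatrix]
  · rw [curveWeight_succ_castSucc]
    simp [monomialCurveMatrix]

theorem IsRationalSolution.isReducedSolution (hk : ∀ i, k i ≤ d) {α : Fin 2 → ℤ}
    {φ : RatFun (m + 2)}
    (h : IsRationalSolution (monomialCurveMatrix k d) (fun i => (α i : ℂ)) φ) :
    IsReducedSolution (curveWeight k d) 0 (Fin.last (m + 1)) Finset.univ (α 0) (α 1) φ where
  toric j _ := by
    have hj := curveWeight_le hk j
    rw [curveWeight_last, ← monomialD_single, ← monomialD_single, ← monomialD_single,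
      ← Module.End.mul_apply, ← monomialD_add]
    refine h.monomialD_apply_eq ?_
    have hsum (i : Fin 2) (s : Fin (m + 2)) (n : ℕ) :
        ∑ t, monomialCurveMatrix k d i t * ((Pi.single s n : Fin (m + 2) → ℕ) t : ℤ) =
          monomialCurveMatrix k d i s * n := by
      simp [Pi.single_apply]
    ext i
    simp only [Matrix.mulVec, dotProduct, Pi.add_apply, Nat.cast_add, mul_add,
      Finset.sum_add_distrib, hsum]
    fin_cases i
    · simp [monomialCurveMatrix, hj]
    · simp [monomialCurveMatrix_one, curveWeight_zero, curveWeight_last, mul_comm]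
  degree := by
    rw [← h.euler 0]
    refine Finset.sum_congr rfl fun i _ => ?_
    simp [monomialCurveMatrix, theta, eulerOperator_apply]
  weight := by
    rw [← h.euler 1]
    refine Finset.sum_congr rfl fun i _ => ?_
    rw [monomialCurveMatrix_one, theta, eulerOperator_apply, Int.cast_natCast, mul_assoc,
      Algebra.smul_def, map_natCast]

end MonomialCurve

end AHypergeometric

end

open AHypergeometric in
theorem theorem1p9_general {m : ℕ} {k : Fin m → ℕ} {d : ℕ} (hk_le : ∀ i, k i ≤ d) {i : Fin m}
    (hi_pos : 0 < k i) (hi_lt : k i < d) {α : Fin 2 → ℤ} (hα : α ∈ eulerJacobiCone d)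
    {φ : RatFun (m + 2)}
    (hφ : IsRationalSolution (monomialCurveMatrix k d) (fun i => (α i : ℂ)) φ) : φ = 0 := by
  refine (hφ.isReducedSolution hk_le).eq_zero (j := i.castSucc.succ) (Fin.succ_ne_zero _).symm ?_
    (Fin.last_pos.ne') ?_ (curveWeight_zero k d) ?_ ?_ (Finset.subset_univ _) ?_ hα.2
  · rw [← Fin.succ_last]
    exact fun h => (Fin.castSucc_lt_last i).ne' (Fin.succ_injective _ h)
  · simpa only [curveWeight_last] using curveWeight_le hk_le
  · rwa [curveWeight_succ_castSucc]
  · rwa [curveWeight_succ_castSucc, curveWeight_last]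
  · simpa only [curveWeight_last] using hα.1

theorem theorem1p9 (m : ℕ) (hm : 1 ≤ m) (k : Fin m → ℕ) (d : ℕ)
    (hk_pos : ∀ i, 0 < k i) (hk_mono : StrictMono k) (hk_lt : ∀ i, k i < d)
    (hgcd : Nat.gcd (Finset.univ.gcd k) d = 1)
    (α : Fin 2 → ℤ) (hα : α ∈ AHypergeometric.eulerJacobiCone d)
    (φ : AHypergeometric.RatFun (m + 2))
    (hφ : AHypergeometric.IsRationalSolution (AHypergeometric.monomialCurveMatrix k d)
      (fun i => (α i : ℂ)) φ) :
    φ = 0 := by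
  exact theorem1p9_general (fun i => (hk_lt i).le) (hk_pos ⟨0, hm⟩) (hk_lt ⟨0, hm⟩) hα hφ
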